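/- All rings are commutative with $1$. Let $R$ be a ring and $S=R[x_1,\dots,x_N]$ a polynomial ring. A \emph{quasi-matrix} over $S$ is a rectangular array of elements of $S$ in which some positions may be empty; it is \emph{generic} if its entries are pairwise distinct variables of $S$. A \emph{subquasi-matrix} is obtained by deleting some rows, columns or elements. A quasi-matrix is \emph{binary} if each nonempty row and each nonempty column contains exactly two elements. A \emph{binary quasi-determinant} of an $n\times n$ binary quasi-matrix $(c_{ij})$, $n\ge 1$, is an element $$c_{1\sigma(1)}\cdots c_{n\sigma(n)}-c_{1\tau(1)}\cdots c_{n\tau(n)},$$ where $\sigma,\tau$ are permutations of $\{1,\dots,n\}$ with $\sigma(l)\ne\tau(l)$ for all $l$ and all the entries $c_{l\sigma(l)}$, $c_{l\tau(l)}$ are present. The \emph{binary quasi-minors} of a quasi-matrix $B$ are the binary quasi-determinants of its square binary subquasi-matrices, and $I_{bin}(B)$ is the ideal that they generate. \textbf{Proposition.} Let $\underline{s}=s_1,\dots,s_k$ be a permutable weak regular sequence in $R$, i.e. for every permutation $\pi$ of $\{1,\dots,k\}$ and every $i$, multiplication by $s_{\pi(i)}$ is injective on $R/\langle s_{\pi(1)},\dots,s_{\pi(i-1)}\rangle$,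 and suppose that no $s_i$ is a unit of $R$. Let $A$ be a generic quasi-matrix over $S$ with $k$ rows, and let $B=(\underline{s}\mid A)$ be the quasi-matrix obtained by adding the column with entries $s_1,\dots,s_k$ on the left of $A$. Then the set $G$ of binary quasi-minors of $B$ is a universal Gröbner basis of $I_{bin}(B)$: $G$ is a finite subset of $I_{bin}(B)$ and, for every monomial order on $S$, the ideal generated by the leading terms (coefficients included) of the elements of $G$ equals the ideal generated by the leading terms of all elements of $I_{bin}(B)$. -/

import Mathlib

open MvPolynomial

universe u v w

/-- An `n × m` quasi-matrix over `R`: a rectangular array some of whose entries may be empty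
(`none`). -/
def QuasiMatrix (n m : ℕ) (R : Type u) : Type u :=
  Fin n → Fin m → Option R

namespace QuasiMatrix

variable {R : Type u} {n m n' m' : ℕ}

/-- `A'` is a subquasi-matrix of `A`: it is obtained from `A` by deleting some rows and columns
(keeping those in the ranges of the increasing maps `r`, `c`) and then some elements. -/
def IsSubquasiMatrix (A' : QuasiMatrix n' m' R) (A : QuasiMatrix n m R) : Prop :=
  ∃ (r : Fin n' ↪o Fin n) (c : Fin m' ↪o Fin m),
    ∀ i j, A' i j = none ∨ A' i j = A (r i) (c j)

/-- A binary quasi-matrix: every nonempty row and every nonempty column has exactly two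
elements. -/
def IsBinary (A : QuasiMatrix n m R) : Prop :=
  (∀ i, (∃ j, A i j ≠ none) → {j | A i j ≠ none}.ncard = 2) ∧
  (∀ j, (∃ i, A i j ≠ none) → {i | A i j ≠ none}.ncard = 2)

/-- `d` is a binary quasi-determinant of the `n × n` quasi-matrix `A`:
`d = ∏ i, A i (σ i) - ∏ i, A i (τ i)` for permutations `σ`, `τ` that differ at every point, where
all the entries that occur are present in `A`. -/
def IsBinaryQuasiDet [CommRing R] (A : QuasiMatrix n n R) (d : R) : Prop :=
  A.IsBinary ∧ ∃ (σ τ : Equiv.Perm (Fin n)) (a b : Fin n → R),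
    (∀ l, σ l ≠ τ l) ∧ (∀ l, A l (σ l) = some (a l)) ∧ (∀ l, A l (τ l) = some (b l)) ∧
    d = ∏ l, a l - ∏ l, b l

/-- The set of binary quasi-minors of `A`: the binary quasi-determinants of the (nonempty, square)
binary subquasi-matrices of `A`. -/
def binaryQuasiMinors [CommRing R] (A : QuasiMatrix n m R) : Set R :=
  {d | ∃ (p : ℕ) (C : QuasiMatrix p p R), 0 < p ∧ C.IsSubquasiMatrix A ∧ C.IsBinaryQuasiDet d}

/-- The ideal `I_bin(A)` generated by the binary quasi-minors of `A`. -/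
def Ibin [CommRing R] (A : QuasiMatrix n m R) : Ideal R :=
  Ideal.span A.binaryQuasiMinors

/-- The quasi-matrix `(s | A)` obtained by adding the full column `s` on the left of `A`. -/
def addCol (s : Fin n → R) (A : QuasiMatrix n m R) : QuasiMatrix n (m + 1) R :=
  fun i => Fin.cons (some (s i)) (A i)

/-- A quasi-matrix over a polynomial ring is generic if its entries are distinct variables. -/
def IsGeneric {ι : Type v} [CommRing R] (A : QuasiMatrix n m (MvPolynomial ι R)) : Prop :=
  (∀ i j a, A i j = some a → ∃ x : ι, a = X x) ∧
  (∀ i j i' j' a, A i j = some a → A i' j' = some a → i = i' ∧ j = j')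

end QuasiMatrix

/-- `s` is a permutable weak regular sequence in `R`: every rearrangement of it is a weakly regular
sequence on `R`. -/
def IsPermutableWeakRegular {R : Type u} [CommRing R] {k : ℕ} (s : Fin k → R) : Prop :=
  ∀ π : Equiv.Perm (Fin k), RingTheory.Sequence.IsWeaklyRegular R (List.ofFn fun i => s (π i))

/-- `G` is a Gröbner basis of the ideal `I` for the monomial order `ord`: a finite subset of `I`
whose leading terms (coefficients included) generate the ideal generated by the leading terms of
all elements of `I`. -/
def IsGroebnerBasis {ι : Type v} {R : Type u} [CommRing R] (ord : MonomialOrder.{v, w} ι)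
    (G : Set (MvPolynomial ι R)) (I : Ideal (MvPolynomial ι R)) : Prop :=
  G.Finite ∧ G ⊆ (I : Set (MvPolynomial ι R)) ∧
    Ideal.span (ord.leadingTerm '' G) =
      Ideal.span (ord.leadingTerm '' (I : Set (MvPolynomial ι R)))

/-- `G` is a universal Gröbner basis of `I`: a Gröbner basis for every monomial order. -/
def IsUniversalGroebnerBasis {ι : Type v} {R : Type u} [CommRing R]
    (G : Set (MvPolynomial ι R)) (I : Ideal (MvPolynomial ι R)) : Prop :=
  ∀ ord : MonomialOrder.{v, w} ι, IsGroebnerBasis ord G I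

/-!
Let `x_ij` denote the variable at position `(i, j)` of `A`. The `R`-algebra homomorphism
`rowColumnHom`, sending `x_ij` to `s_i t_j` with one new variable `t_j` for each column of `A` and
fixing the other variables, kills every binary quasi-minor of `(s | A)`: the two products in it
involve the same rows and the same columns. It therefore suffices to show that the leading term of
every `f` in the kernel lies in the ideal `L` generated by the leading terms of the binary
quasi-minors.

Let `u₀` be the leading exponent of `f`, with coefficient `c`, and write `ρ u` for the vector
counting the variables of each row in `u`. Comparing coefficients of a monomial in the `t_j` gives
`c s ^ ρ u₀ ∈ ⟨s ^ ρ u⟩`, where `u` runs over the other exponents of `f` with the same column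
degrees as `u₀`; these are smaller than `u₀`. Two facts finish the proof.

* Monomial ideals in a permutable weakly regular sequence have the same colon ideals by monomials
  as in a polynomial ring (`mem_of_monomialIn_mul_mem`). Hence `c` lies in the ideal generated by
  the monomials `s ^ (ρ u - ρ u₀)`, with truncated subtraction.
* For each such `u`, the term `s ^ (ρ u - ρ u₀) x ^ u₀` lies in `L`
  (`IsPlacement.monomial_mem_span_leadingTerm`). Indeed, the multiplicities of the entries of
  `(s | A)` in `s ^ (ρ u - ρ u₀) x ^ u₀` and in `s ^ (ρ u₀ - ρ u) x ^ u` form two matrices with the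
  same row sums and the same column sums. Such a pair decomposes into pairs of matchings with the
  same rows and columns, and since `u < u₀`, in one of these pairs the matching taken from `u₀` is
  the larger one (`exists_disjoint_matchings_of_weight_lt`). It is the leading term of a binary
  quasi-minor, with nonzero coefficient because the `s_i` are nonzerodivisors, and it divides
  `s ^ (ρ u - ρ u₀) x ^ u₀`.
-/

/-! ### Monomial ideals in a permutable weakly regular sequence -/

section MonomialIdeals

variable {R : Type u} [CommRing R] {κ : Type*}

theorem eq_single_add_sub [DecidableEq κ] {b : κ → ℕ} {i : κ} (h : b i ≠ 0) :
    b = Pi.single i 1 + (b - Pi.single i 1) := by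
  funext l
  by_cases hl : l = i
  · subst hl
    simp only [Pi.add_apply, Pi.sub_apply, Pi.single_eq_same]
    omega
  · simp [hl]

theorem sub_single_eq_self [DecidableEq κ] {b : κ → ℕ} {i : κ} (h : b i = 0) :
    b - Pi.single i 1 = b := by
  funext l
  by_cases hl : l = i
  · subst hl
    simp [h]
  · simp [hl]

variable [Fintype κ]

/-- The monomial `∏ i, s i ^ b i` in the elements of the family `s`. -/
def monomialIn (s : κ → R) (b : κ → ℕ) : R :=
  ∏ i, s i ^ b i

/-- The ideal generated by the monomials in `s` with exponents in `E`. A multiset is used so that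
truncating exponents does not change the number of generators. -/
def monomialIdealIn (s : κ → R) (E : Multiset (κ → ℕ)) : Ideal R :=
  Ideal.span (monomialIn s '' {b | b ∈ E})

theorem monomialIn_zero (s : κ → R) : monomialIn s 0 = 1 := by
  simp [monomialIn]

theorem monomialIn_add (s : κ → R) (a b : κ → ℕ) :
    monomialIn s (a + b) = monomialIn s a * monomialIn s b := by
  simp [monomialIn, pow_add, Finset.prod_mul_distrib]

theorem monomialIn_single [DecidableEq κ] (s : κ → R) (i : κ) :
    monomialIn s (Pi.single i 1) = s i := by
  rw [monomialIn, Finset.prod_eq_single i]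
  · simp
  · intro j _ hj
    simp [hj]
  · simp

theorem monomialIn_mem {s : κ → R} {E : Multiset (κ → ℕ)} {b : κ → ℕ} (hb : b ∈ E) :
    monomialIn s b ∈ monomialIdealIn s E :=
  Ideal.subset_span ⟨b, hb, rfl⟩

theorem monomialIdealIn_le_iff {s : κ → R} {E : Multiset (κ → ℕ)} {I : Ideal R} :
    monomialIdealIn s E ≤ I ↔ ∀ b ∈ E, monomialIn s b ∈ I := by
  rw [monomialIdealIn, Ideal.span_le]
  exact Set.image_subset_iff

theorem monomialIdealIn_mono {s : κ → R} {E F : Multiset (κ → ℕ)} (h : E ⊆ F) :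
    monomialIdealIn s E ≤ monomialIdealIn s F :=
  monomialIdealIn_le_iff.2 fun _ hb => monomialIn_mem (h hb)

variable [DecidableEq κ]

theorem sum_sub_single_lt {b : κ → ℕ} {i : κ} (h : b i ≠ 0) :
    ∑ l, (b - Pi.single i 1 : κ → ℕ) l < ∑ l, b l := by
  conv_rhs => rw [eq_single_add_sub h]
  simp [Finset.sum_add_distrib]

/-- The sum of the degrees of all generators. -/
def totalExponent (E : Multiset (κ → ℕ)) : ℕ :=
  (E.map fun b => ∑ i, b i).sum

/-- A multiple of `s i` in a monomial ideal is, modulo the generators not involving `s i`, `s i`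
times a combination of the generators with one `s i` removed. -/
theorem exists_mul_mem_filter (s : κ → R) (E : Multiset (κ → ℕ)) (i : κ) {x : R}
    (hx : x ∈ monomialIdealIn s E) :
    ∃ g ∈ monomialIdealIn s ((E.filter fun b => b i ≠ 0).map fun b : κ → ℕ => b - Pi.single i 1),
      x - s i * g ∈ monomialIdealIn s (E.filter fun b => b i = 0) := by
  rw [monomialIdealIn] at hx
  induction hx using Submodule.span_induction with
  | mem x hx =>
    obtain ⟨b, hb, rfl⟩ := hx
    by_cases h : b i = 0
    · exact ⟨0, zero_mem _, by simpa using monomialIn_mem (Multiset.mem_filter.2 ⟨hb, h⟩)⟩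
    · refine ⟨monomialIn s (b - Pi.single i 1), monomialIn_mem
        (Multiset.mem_map_of_mem _ (Multiset.mem_filter.2 ⟨hb, h⟩)), ?_⟩
      rw [← monomialIn_single s i, ← monomialIn_add, ← eq_single_add_sub h, sub_self]
      exact zero_mem _
  | zero => exact ⟨0, zero_mem _, by simp⟩
  | add x y _ _ hx hy =>
    obtain ⟨g, hg, hx⟩ := hx
    obtain ⟨g', hg', hy⟩ := hy
    refine ⟨g + g', add_mem hg hg', ?_⟩
    convert add_mem hx hy using 1
    ring
  | smul a x _ hx =>
    obtain ⟨g, hg, hx⟩ := hx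
    refine ⟨a * g, Ideal.mul_mem_left _ _ hg, ?_⟩
    convert Ideal.mul_mem_left _ a hx using 1
    rw [smul_eq_mul]
    ring

/-- A variable is a nonzerodivisor modulo any monomial ideal not involving it, provided that this
holds for the ideals generated by some of the other variables. The induction is on the total
degree of the generators: if some generator has degree at least two and involves `s j`, then the
claim for `E` follows from those for `(E, s j)` and `E : s j`. -/
theorem mem_of_mul_mem_monomialIdealIn {s : κ → R}
    (hs : ∀ (U : Finset κ) (i : κ), i ∉ U → ∀ c, s i * c ∈ Ideal.span (s '' U) →
      c ∈ Ideal.span (s '' U)) (E : Multiset (κ → ℕ)) (i : κ) (hE : ∀ b ∈ E, b i = 0) (c : R)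
    (hc : s i * c ∈ monomialIdealIn s E) : c ∈ monomialIdealIn s E := by
  induction hn : totalExponent E using Nat.strong_induction_on generalizing E i c with
  | _ n ih =>
  subst hn
  by_cases hdeg : ∃ b ∈ E, 2 ≤ ∑ l, b l
  · obtain ⟨b, hb, hb2⟩ := hdeg
    obtain ⟨j, hj⟩ : ∃ j, b j ≠ 0 := by
      by_contra! h
      simp [h] at hb2
    have hij : i ≠ j := by
      rintro rfl
      exact hj (hE b hb)
    set E₀ := E.filter fun b => b j = 0 with hE₀
    set E₁ := E.filter fun b => b j ≠ 0 with hE₁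
    have hsplit : totalExponent E = totalExponent E₀ + totalExponent E₁ := by
      conv_lhs => rw [← Multiset.filter_add_not (fun b : κ → ℕ => b j = 0) E]
      simp only [totalExponent, Multiset.map_add, Multiset.sum_add, hE₀, hE₁, ne_eq]
    have hbE₁ : b ∈ E₁ := Multiset.mem_filter.2 ⟨hb, hj⟩
    have hE₁deg : 2 ≤ totalExponent E₁ :=
      hb2.trans (Multiset.single_le_sum (fun _ _ => Nat.zero_le _) _
        (Multiset.mem_map_of_mem (fun b : κ → ℕ => ∑ l, b l) hbE₁))
    have hE₀E : monomialIdealIn s E₀ ≤ monomialIdealIn s E :=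
      monomialIdealIn_mono (Multiset.filter_subset _ _)
    set E₁' := E₁.map fun b : κ → ℕ => b - Pi.single j 1 with hE₁'
    have hE₁'deg : totalExponent E₁' < totalExponent E₁ := by
      rw [hE₁', totalExponent, totalExponent, Multiset.map_map]
      refine Multiset.sum_lt_sum_of_nonempty (by rintro h; simp [h] at hbE₁) fun a ha => ?_
      exact sum_sub_single_lt (Multiset.mem_filter.1 ha).2
    have hjE₁' : ∀ g ∈ monomialIdealIn s E₁', s j * g ∈ monomialIdealIn s E := by
      intro g hg
      have : monomialIdealIn s E₁' ≤
          Submodule.comap (LinearMap.mulLeft R (s j)) (monomialIdealIn s E) := by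
        rw [monomialIdealIn_le_iff]
        intro a ha
        obtain ⟨a, ha', rfl⟩ := Multiset.mem_map.1 ha
        obtain ⟨haE, haj⟩ := Multiset.mem_filter.1 ha'
        rw [Submodule.mem_comap, LinearMap.mulLeft_apply, ← monomialIn_single s j,
          ← monomialIn_add, ← eq_single_add_sub haj]
        exact monomialIn_mem haE
      exact this hg
    -- `c` lies in the ideal generated by `s j` and the generators not involving `s j`
    have h₁ : c ∈ monomialIdealIn s (Pi.single j 1 ::ₘ E₀) := by
      refine ih _ ?_ (Pi.single j 1 ::ₘ E₀) i ?_ c ?_ rfl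
      · simp only [totalExponent, Multiset.map_cons, Multiset.sum_cons] at hsplit hE₁deg ⊢
        have : ∑ l, (Pi.single j 1 : κ → ℕ) l = 1 := by simp
        omega
      · intro a ha
        rcases Multiset.mem_cons.1 ha with rfl | ha
        · simp [hij]
        · exact hE a (Multiset.mem_filter.1 ha).1
      · obtain ⟨g, -, hg⟩ := exists_mul_mem_filter s E j hc
        have h1 := monomialIdealIn_mono (Multiset.subset_cons E₀ (Pi.single j 1)) hg
        have h2 : s j ∈ monomialIdealIn s (Pi.single j 1 ::ₘ E₀) := by
          rw [← monomialIn_single s j]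
          exact monomialIn_mem (Multiset.mem_cons_self _ _)
        convert add_mem h1 (Ideal.mul_mem_right g _ h2) using 1
        ring
    obtain ⟨d, e, he, hcd⟩ : ∃ d, ∃ e ∈ monomialIdealIn s E₀, c = s j * d + e := by
      have hle : monomialIdealIn s (Pi.single j 1 ::ₘ E₀) ≤
          Ideal.span {s j} ⊔ monomialIdealIn s E₀ := by
        rw [monomialIdealIn_le_iff]
        intro a ha
        rcases Multiset.mem_cons.1 ha with rfl | ha
        · rw [monomialIn_single]
          exact Ideal.mem_sup_left (Ideal.mem_span_singleton_self _)
        · exact Ideal.mem_sup_right (monomialIn_mem ha)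
      obtain ⟨y, hy, e, he, rfl⟩ := Submodule.mem_sup.1 (hle h₁)
      obtain ⟨d, rfl⟩ := Ideal.mem_span_singleton'.1 hy
      exact ⟨d, e, he, by ring⟩
    have h₂ : s j * (s i * d) ∈ monomialIdealIn s E := by
      convert sub_mem hc (Ideal.mul_mem_left _ (s i) (hE₀E he)) using 1
      rw [hcd]
      ring
    obtain ⟨g, hg, hg'⟩ := exists_mul_mem_filter s E j h₂
    have h₃ : s i * d - g ∈ monomialIdealIn s E₀ := by
      refine ih _ (by omega) E₀ j (fun a ha => (Multiset.mem_filter.1 ha).2) _ ?_ rfl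
      rwa [mul_sub]
    have h₄ : d ∈ monomialIdealIn s (E₀ + E₁') := by
      refine ih _ ?_ (E₀ + E₁') i ?_ d ?_ rfl
      · have : totalExponent (E₀ + E₁') = totalExponent E₀ + totalExponent E₁' := by
          simp [totalExponent]
        omega
      · intro a ha
        rcases Multiset.mem_add.1 ha with ha | ha
        · exact hE a (Multiset.mem_filter.1 ha).1
        · obtain ⟨a, ha', rfl⟩ := Multiset.mem_map.1 ha
          simp [hE a (Multiset.mem_filter.1 ha').1]
      · have h3 := monomialIdealIn_mono (Multiset.subset_of_le (Multiset.le_add_right E₀ E₁')) h₃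
        have h4 := monomialIdealIn_mono (Multiset.subset_of_le (Multiset.le_add_left E₁' E₀)) hg
        simpa using add_mem h3 h4
    obtain ⟨y, hy, z, hz, rfl⟩ : ∃ y ∈ monomialIdealIn s E₀, ∃ z ∈ monomialIdealIn s E₁',
        y + z = d := by
      refine Submodule.mem_sup.1 ((monomialIdealIn_le_iff.2 ?_ :
        monomialIdealIn s (E₀ + E₁') ≤ monomialIdealIn s E₀ ⊔ monomialIdealIn s E₁') h₄)
      intro a ha
      rcases Multiset.mem_add.1 ha with ha | ha
      · exact Ideal.mem_sup_left (monomialIn_mem ha)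
      · exact Ideal.mem_sup_right (monomialIn_mem ha)
    rw [hcd, mul_add]
    exact add_mem (add_mem (Ideal.mul_mem_left _ _ (hE₀E hy)) (hjE₁' z hz)) (hE₀E he)
  · push Not at hdeg
    by_cases h0 : (0 : κ → ℕ) ∈ E
    · have := monomialIn_mem (s := s) h0
      rw [monomialIn_zero] at this
      rw [(Ideal.eq_top_iff_one _).2 this]
      trivial
    · -- every generator is one of the variables
      have key : monomialIdealIn s E =
          Ideal.span (s '' (Finset.univ.filter fun j => Pi.single j 1 ∈ E : Finset κ)) := by
        refine le_antisymm (monomialIdealIn_le_iff.2 fun b hb => ?_) (Ideal.span_le.2 ?_)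
        · obtain ⟨j, hj⟩ : ∃ j, b j ≠ 0 := by
            by_contra! h
            exact h0 (by rwa [show (0 : κ → ℕ) = b from (funext h).symm])
          have hb' : b = Pi.single j 1 := by
            have h1 := sum_sub_single_lt hj
            have h2 := hdeg b hb
            have h3 : ∑ l, (b - Pi.single j 1 : κ → ℕ) l = 0 := by omega
            have h4 : b - Pi.single j 1 = 0 := by
              funext l
              exact Finset.sum_eq_zero_iff.1 h3 l (Finset.mem_univ _)
            have h5 := eq_single_add_sub hj
            rwa [h4, add_zero] at h5
          subst hb'
          rw [monomialIn_single]
          exact Ideal.subset_span ⟨j, by simpa using hb, rfl⟩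
        · rintro _ ⟨j, hj, rfl⟩
          rw [← monomialIn_single s j]
          exact monomialIn_mem (by simpa using hj)
      rw [key] at hc ⊢
      refine hs _ i ?_ c hc
      intro hi
      have := hE _ (Finset.mem_filter.1 hi).2
      simp at this

/-- The colon ideal of a monomial ideal by a monomial is what it is in a polynomial ring. -/
theorem mem_of_monomialIn_mul_mem {s : κ → R}
    (hs : ∀ (U : Finset κ) (i : κ), i ∉ U → ∀ c, s i * c ∈ Ideal.span (s '' U) →
      c ∈ Ideal.span (s '' U)) (E : Multiset (κ → ℕ)) (a : κ → ℕ) (c : R)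
    (hc : monomialIn s a * c ∈ monomialIdealIn s E) :
    c ∈ monomialIdealIn s (E.map fun b : κ → ℕ => b - a) := by
  induction hn : ∑ i, a i generalizing E a c with
  | zero =>
    have ha : a = 0 := funext fun i => Finset.sum_eq_zero_iff.1 hn i (Finset.mem_univ _)
    subst ha
    simpa [monomialIn_zero] using hc
  | succ n ih =>
    obtain ⟨i, hi⟩ : ∃ i, a i ≠ 0 := by
      by_contra! h
      simp [h] at hn
    have ha := eq_single_add_sub hi
    have hn' : ∑ l, (a - Pi.single i 1 : κ → ℕ) l = n := by
      rw [ha] at hn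
      simp only [Pi.add_apply, Finset.sum_add_distrib] at hn
      have : ∑ l, (Pi.single i 1 : κ → ℕ) l = 1 := by simp
      omega
    rw [ha, monomialIn_add, monomialIn_single, mul_assoc] at hc
    obtain ⟨g, hg, hg'⟩ := exists_mul_mem_filter s E i hc
    rw [← mul_sub] at hg'
    have h1 := mem_of_mul_mem_monomialIdealIn hs _ i
      (fun b hb => (Multiset.mem_filter.1 hb).2) _ hg'
    have h2 : monomialIn s (a - Pi.single i 1) * c ∈
        monomialIdealIn s (E.map fun b : κ → ℕ => b - Pi.single i 1) := by
      have h3 : monomialIdealIn s (E.filter fun b => b i = 0) ≤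
          monomialIdealIn s (E.map fun b : κ → ℕ => b - Pi.single i 1) := by
        rw [monomialIdealIn_le_iff]
        intro b hb
        obtain ⟨hb, hbi⟩ := Multiset.mem_filter.1 hb
        exact monomialIn_mem (Multiset.mem_map.2 ⟨b, hb, sub_single_eq_self hbi⟩)
      have h4 := monomialIdealIn_mono
        (Multiset.map_subset_map (f := fun b : κ → ℕ => b - Pi.single i 1)
          (Multiset.filter_subset (fun b : κ → ℕ => b i ≠ 0) E)) hg
      simpa using add_mem (h3 h1) h4
    convert ih _ _ c h2 hn' using 2
    rw [Multiset.map_map]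
    refine Multiset.map_congr rfl fun b _ => ?_
    rw [Function.comp_apply, tsub_tsub, ← ha]

end MonomialIdeals

/-- In a permutable weakly regular sequence each element is a nonzerodivisor modulo any set of
other elements of the sequence. -/
theorem IsPermutableWeakRegular.mem_span_of_mul_mem {R : Type u} [CommRing R] {k : ℕ}
    {s : Fin k → R} (hs : IsPermutableWeakRegular s) (U : Finset (Fin k)) (i : Fin k)
    (hi : i ∉ U) (c : R) (hc : s i * c ∈ Ideal.span (s '' U)) : c ∈ Ideal.span (s '' U) := by
  classical
  set V : Finset (Fin k) := (insert i U)ᶜ with hV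
  set l : List (Fin k) := U.toList ++ i :: V.toList with hl
  have hnd : l.Nodup := by
    refine List.Nodup.append U.nodup_toList (List.nodup_cons.2 ⟨by simp [hV], V.nodup_toList⟩) ?_
    intro x hx hx'
    rw [Finset.mem_toList] at hx
    rcases List.mem_cons.1 hx' with rfl | hx'
    · exact hi hx
    · rw [Finset.mem_toList, hV, Finset.mem_compl] at hx'
      exact hx' (Finset.mem_insert_of_mem hx)
  have hmem : ∀ x, x ∈ l := by
    intro x
    by_cases h1 : x ∈ U
    · simp [hl, h1]
    · by_cases h2 : x = i
      · simp [hl, h2]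
      · simp [hl, hV, h1, h2]
  let e := hnd.getEquivOfForallMemList l hmem
  have hlen : l.length = k := by simpa using Fintype.card_congr e
  have hreg := hs ((finCongr hlen.symm).trans e)
  have hlist : (List.ofFn fun j => s (((finCongr hlen.symm).trans e) j)) = l.map s := by
    refine List.ext_getElem (by simp [hlen]) fun n h1 h2 => ?_
    simp [e, List.Nodup.getEquivOfForallMemList]
  rw [hlist, hl, List.map_append, List.map_cons] at hreg
  have h := ((RingTheory.Sequence.isWeaklyRegular_append_iff R _ _).1 hreg).2
  rw [RingTheory.Sequence.isWeaklyRegular_cons_iff] at h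
  have hspan : (Ideal.ofList (U.toList.map s) • ⊤ : Submodule R R) = Ideal.span (s '' U) := by
    rw [smul_eq_mul, Ideal.mul_top, Ideal.ofList]
    congr 1
    ext x
    simp
  have h1 := h.1
  rw [hspan] at h1
  have h2 : s i • Submodule.Quotient.mk (p := (Ideal.span (s '' U) : Submodule R R)) c =
      s i • Submodule.Quotient.mk 0 := by
    rw [Submodule.Quotient.mk_zero, smul_zero, ← Submodule.Quotient.mk_smul,
      Submodule.Quotient.mk_eq_zero, smul_eq_mul]
    exact hc
  have h3 := h1 h2
  rwa [Submodule.Quotient.mk_zero, Submodule.Quotient.mk_eq_zero] at h3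

/-! ### Cycles in pairs of matrices with equal margins -/

section Margins

variable {κ μ : Type*} [Fintype κ] [Fintype μ]

/-- Two nonzero nonnegative integer matrices with the same row sums and column sums contain two
matchings with the same rows and the same columns: walking from a row along an entry of `P` to a
column and back along an entry of `Q` defines a self-map of the nonzero rows, and its periodic
points are the rows of the matchings. -/
theorem exists_matchings_of_margins_eq (P Q : κ → μ → ℕ)
    (hrow : ∀ i, ∑ j, P i j = ∑ j, Q i j) (hcol : ∀ j, ∑ i, P i j = ∑ i, Q i j)
    (hP : P ≠ 0) :
    ∃ (T : Finset κ) (α β : κ → μ), T.Nonempty ∧ Set.InjOn α T ∧ Set.InjOn β T ∧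
      α '' T = β '' T ∧ (∀ i ∈ T, P i (α i) ≠ 0) ∧ (∀ i ∈ T, Q i (β i) ≠ 0) := by
  classical
  have hPne : ∃ i j, P i j ≠ 0 := by
    by_contra! h
    exact hP (funext fun i => funext fun j => h i j)
  obtain ⟨i₀, j₀, h₀⟩ := hPne
  have hQP : ∀ i j, Q i j ≠ 0 → ∃ j', P i j' ≠ 0 := by
    intro i j hij
    by_contra! h
    have h1 := hrow i
    rw [Finset.sum_eq_zero fun j _ => h j] at h1
    exact hij (Finset.sum_eq_zero_iff.1 h1.symm j (Finset.mem_univ _))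
  have hPQ : ∀ i j, P i j ≠ 0 → ∃ i', Q i' j ≠ 0 := by
    intro i j hij
    by_contra! h
    have h1 := hcol j
    rw [Finset.sum_eq_zero (f := fun i => Q i j) fun i _ => h i] at h1
    exact hij (Finset.sum_eq_zero_iff.1 h1 i (Finset.mem_univ _))
  have hα' : ∀ i : κ, ∃ j : μ, (∃ j', P i j' ≠ 0) → P i j ≠ 0 := fun i =>
    (em (∃ j', P i j' ≠ 0)).elim (fun ⟨j, hj⟩ => ⟨j, fun _ => hj⟩)
      fun h => ⟨j₀, fun h' => absurd h' h⟩
  have hr' : ∀ j : μ, ∃ i : κ, (∃ i', P i' j ≠ 0) → Q i j ≠ 0 := fun j =>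
    (em (∃ i', P i' j ≠ 0)).elim (fun ⟨i, hi⟩ => (hPQ i j hi).imp fun _ h _ => h)
      fun h => ⟨i₀, fun h' => absurd h' h⟩
  choose α hα using hα'
  choose r hr using hr'
  let f : κ → κ := fun i => r (α i)
  let V : Set κ := {i | ∃ j', P i j' ≠ 0}
  have hfV : ∀ i, i ∈ V → f i ∈ V := fun i hi => hQP _ _ (hr _ ⟨i, hα i hi⟩)
  have hiter : ∀ n i, i ∈ V → f^[n] i ∈ V := by
    intro n
    induction n with
    | zero => exact fun i hi => hi
    | succ n ih => exact fun i hi => ih _ (hfV i hi)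
  -- the orbit of a nonzero row eventually becomes periodic
  obtain ⟨m, n, hmn, heq⟩ : ∃ m n, m < n ∧ f^[m] i₀ = f^[n] i₀ := by
    obtain ⟨m, n, hmn, heq⟩ := Finite.exists_ne_map_eq_of_infinite fun n : ℕ => f^[n] i₀
    rcases lt_or_gt_of_ne hmn with h | h
    · exact ⟨m, n, h, heq⟩
    · exact ⟨n, m, h, heq.symm⟩
  let T : Finset κ := Finset.univ.filter fun i => i ∈ V ∧ i ∈ Function.periodicPts f
  have hTmem : ∀ i, i ∈ T ↔ i ∈ V ∧ i ∈ Function.periodicPts f := by simp [T]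
  have hTne : T.Nonempty := by
    refine ⟨f^[m] i₀, (hTmem _).2 ⟨hiter _ _ ⟨j₀, h₀⟩, ?_⟩⟩
    refine Function.mk_mem_periodicPts (n := n - m) (by omega) ?_
    rw [Function.IsPeriodicPt, Function.IsFixedPt, ← Function.iterate_add_apply,
      Nat.sub_add_cancel hmn.le, heq]
  have hfT : ∀ i ∈ T, f i ∈ T := by
    intro i hi
    rw [hTmem] at hi ⊢
    exact ⟨hfV i hi.1, (Function.bijOn_periodicPts f).mapsTo hi.2⟩
  have hfinj : Set.InjOn f T := (Function.bijOn_periodicPts f).injOn.mono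
    fun i hi => ((hTmem i).1 hi).2
  have hfsurj : ∀ i ∈ T, ∃ i' ∈ T, f i' = i :=
    Finset.surjOn_of_injOn_of_card_le f hfT hfinj le_rfl
  choose! g hgT hg using hfsurj
  have hαinj : Set.InjOn α T := fun i hi i' hi' h => hfinj hi hi' (congrArg r h)
  have hgV : ∀ i ∈ T, g i ∈ V := fun i hi => ((hTmem _).1 (hgT i hi)).1
  refine ⟨T, α, fun i => α (g i), hTne, hαinj, ?_, ?_, ?_, ?_⟩
  · intro i hi i' hi' h
    rw [← hg i hi, ← hg i' hi']
    exact congrArg r h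
  · ext j
    constructor
    · rintro ⟨i, hi, rfl⟩
      refine ⟨f i, hfT i hi, congrArg α ?_⟩
      exact hfinj (hgT _ (hfT i hi)) hi (hg _ (hfT i hi))
    · rintro ⟨i, hi, rfl⟩
      exact ⟨g i, hgT i hi, rfl⟩
  · exact fun i hi => hα i ((hTmem i).1 hi).1
  · intro i hi
    have h := hr (α (g i)) ⟨g i, hα _ (hgV i hi)⟩
    rwa [show r (α (g i)) = i from hg i hi] at h

/-- Removing the entries of a partial matching `α` on the rows `T` from a matrix. -/
def removeMatching [DecidableEq μ] [DecidableEq κ] (P : κ → μ → ℕ) (T : Finset κ) (α : κ → μ) :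
    κ → μ → ℕ :=
  fun i j => P i j - if i ∈ T ∧ j = α i then 1 else 0

section removeMatching

variable [DecidableEq κ] [DecidableEq μ] {P : κ → μ → ℕ} {T : Finset κ} {α : κ → μ}

omit [Fintype κ] [Fintype μ] in
theorem removeMatching_add (h : ∀ i ∈ T, P i (α i) ≠ 0) (i : κ) (j : μ) :
    removeMatching P T α i j + (if i ∈ T ∧ j = α i then 1 else 0) = P i j := by
  rw [removeMatching]
  split_ifs with hij
  · have := h i hij.1
    rw [← hij.2] at this
    omega
  · simp

theorem sum_matching {Γ : Type*} [AddCommMonoid Γ] (T : Finset κ) (α : κ → μ) (w : κ → μ → Γ) :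
    ∑ i, ∑ j, (if i ∈ T ∧ j = α i then 1 else 0 : ℕ) • w i j = ∑ i ∈ T, w i (α i) := by
  rw [← Finset.sum_subset (Finset.subset_univ T)]
  · refine Finset.sum_congr rfl fun i hi => ?_
    rw [Finset.sum_eq_single (α i)]
    · simp [hi]
    · intro j _ hj
      simp [hj]
    · simp
  · intro i _ hi
    simp [hi]

theorem sum_removeMatching_add {Γ : Type*} [AddCommMonoid Γ] (h : ∀ i ∈ T, P i (α i) ≠ 0)
    (w : κ → μ → Γ) :
    ∑ i, ∑ j, removeMatching P T α i j • w i j + ∑ i ∈ T, w i (α i) =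
      ∑ i, ∑ j, P i j • w i j := by
  rw [← sum_matching T α w, ← Finset.sum_add_distrib]
  refine Finset.sum_congr rfl fun i _ => ?_
  rw [← Finset.sum_add_distrib]
  refine Finset.sum_congr rfl fun j _ => ?_
  rw [← add_smul, removeMatching_add h]

omit [Fintype κ] in
theorem sum_row_removeMatching_add (h : ∀ i ∈ T, P i (α i) ≠ 0) (i : κ) :
    ∑ j, removeMatching P T α i j + (if i ∈ T then 1 else 0) = ∑ j, P i j := by
  have h1 : ∑ j, (if i ∈ T ∧ j = α i then 1 else 0) = if i ∈ T then 1 else 0 := by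
    by_cases hi : i ∈ T <;> simp [hi]
  rw [← h1, ← Finset.sum_add_distrib]
  exact Finset.sum_congr rfl fun j _ => removeMatching_add h i j

omit [Fintype μ] in
theorem sum_col_removeMatching_add (hα : Set.InjOn α T) (h : ∀ i ∈ T, P i (α i) ≠ 0) (j : μ) :
    ∑ i, removeMatching P T α i j + (if j ∈ T.image α then 1 else 0) = ∑ i, P i j := by
  have h1 : ∑ i, (if i ∈ T ∧ j = α i then 1 else 0) = if j ∈ T.image α then 1 else 0 := by
    split_ifs with hj
    · obtain ⟨i, hi, rfl⟩ := Finset.mem_image.1 hj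
      rw [Finset.sum_eq_single i]
      · simp [hi]
      · intro i' _ hne
        rw [if_neg]
        rintro ⟨hi', h'⟩
        exact hne (hα hi' hi h'.symm)
      · simp
    · refine Finset.sum_eq_zero fun i _ => if_neg ?_
      rintro ⟨hi, rfl⟩
      exact hj (Finset.mem_image_of_mem _ hi)
  rw [← h1, ← Finset.sum_add_distrib]
  exact Finset.sum_congr rfl fun i _ => removeMatching_add h i j

end removeMatching

/-- If `P` and `Q` have equal margins and `P` outweighs `Q`, then some matching inside `P` outweighs
a matching inside `Q` with the same rows and the same columns. Otherwise such matchings could be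
removed from `P` and `Q` until nothing is left. -/
theorem exists_matchings_of_weight_lt {Γ : Type*} [AddCommMonoid Γ] [LinearOrder Γ]
    [IsOrderedCancelAddMonoid Γ] (w : κ → μ → Γ) (P Q : κ → μ → ℕ)
    (hrow : ∀ i, ∑ j, P i j = ∑ j, Q i j) (hcol : ∀ j, ∑ i, P i j = ∑ i, Q i j)
    (hw : ∑ i, ∑ j, Q i j • w i j < ∑ i, ∑ j, P i j • w i j) :
    ∃ (T : Finset κ) (α β : κ → μ), Set.InjOn α T ∧ Set.InjOn β T ∧
      α '' T = β '' T ∧ (∀ i ∈ T, P i (α i) ≠ 0) ∧ (∀ i ∈ T, Q i (β i) ≠ 0) ∧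
      ∑ i ∈ T, w i (β i) < ∑ i ∈ T, w i (α i) := by
  classical
  induction hn : ∑ i, ∑ j, P i j using Nat.strong_induction_on generalizing P Q with
  | _ n ih =>
  subst hn
  have hP : P ≠ 0 := by
    rintro rfl
    have hQ : ∀ i j, Q i j = 0 := fun i j => by
      have h := hrow i
      simp only [Pi.zero_apply, Finset.sum_const_zero] at h
      exact Finset.sum_eq_zero_iff.1 h.symm j (Finset.mem_univ _)
    simp [hQ] at hw
  obtain ⟨T, α, β, hT, hα, hβ, himg, hPα, hQβ⟩ := exists_matchings_of_margins_eq P Q hrow hcol hP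
  rcases lt_or_ge (∑ i ∈ T, w i (β i)) (∑ i ∈ T, w i (α i)) with hlt | hge
  · exact ⟨T, α, β, hα, hβ, himg, hPα, hQβ, hlt⟩
  have himg' : T.image α = T.image β := by
    rw [← Finset.coe_inj]
    simpa using himg
  have hdeg : ∑ i, ∑ j, removeMatching P T α i j < ∑ i, ∑ j, P i j := by
    have h := sum_removeMatching_add hPα fun _ _ => (1 : ℕ)
    simp only [smul_eq_mul, mul_one, Finset.sum_const] at h
    have := hT.card_pos
    omega
  have hrow' : ∀ i, ∑ j, removeMatching P T α i j = ∑ j, removeMatching Q T β i j := by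
    intro i
    have h1 := sum_row_removeMatching_add hPα i
    have h2 := sum_row_removeMatching_add hQβ i
    have h3 := hrow i
    omega
  have hcol' : ∀ j, ∑ i, removeMatching P T α i j = ∑ i, removeMatching Q T β i j := by
    intro j
    have h1 := sum_col_removeMatching_add hα hPα j
    have h2 := sum_col_removeMatching_add hβ hQβ j
    have h3 := hcol j
    rw [himg'] at h1
    omega
  have hw' : ∑ i, ∑ j, removeMatching Q T β i j • w i j <
      ∑ i, ∑ j, removeMatching P T α i j • w i j := by
    have h1 := sum_removeMatching_add hPα w
    have h2 := sum_removeMatching_add hQβ w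
    rw [← h1, ← h2] at hw
    by_contra! hcon
    exact absurd hw (not_lt.2 (add_le_add hcon hge))
  obtain ⟨T', α', β', h1, h2, h3, h4, h5, h6⟩ := ih _ hdeg _ _ hrow' hcol' hw' rfl
  exact ⟨T', α', β', h1, h2, h3,
    fun i hi h => h4 i hi (by rw [removeMatching, h, Nat.zero_sub]),
    fun i hi h => h5 i hi (by rw [removeMatching, h, Nat.zero_sub]), h6⟩

/-- The rows on which the two matchings agree may be dropped. -/
theorem exists_disjoint_matchings_of_weight_lt {Γ : Type*} [AddCommMonoid Γ] [LinearOrder Γ]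
    [IsOrderedCancelAddMonoid Γ] (w : κ → μ → Γ) (P Q : κ → μ → ℕ)
    (hrow : ∀ i, ∑ j, P i j = ∑ j, Q i j) (hcol : ∀ j, ∑ i, P i j = ∑ i, Q i j)
    (hw : ∑ i, ∑ j, Q i j • w i j < ∑ i, ∑ j, P i j • w i j) :
    ∃ (T : Finset κ) (α β : κ → μ), T.Nonempty ∧ Set.InjOn α T ∧ Set.InjOn β T ∧
      α '' T = β '' T ∧ (∀ i ∈ T, α i ≠ β i) ∧
      (∀ i ∈ T, P i (α i) ≠ 0) ∧ (∀ i ∈ T, Q i (β i) ≠ 0) ∧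
      ∑ i ∈ T, w i (β i) < ∑ i ∈ T, w i (α i) := by
  classical
  obtain ⟨T, α, β, hα, hβ, himg, hPα, hQβ, hlt⟩ := exists_matchings_of_weight_lt w P Q hrow hcol hw
  have hsub : ∀ i, i ∈ T.filter (fun i => α i ≠ β i) → i ∈ T := fun i hi =>
    (Finset.mem_filter.1 hi).1
  have hlt' : ∑ i ∈ T.filter (fun i => α i ≠ β i), w i (β i) <
      ∑ i ∈ T.filter (fun i => α i ≠ β i), w i (α i) := by
    rw [← Finset.sum_filter_add_sum_filter_not T (fun i => α i ≠ β i),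
      ← Finset.sum_filter_add_sum_filter_not T (fun i => α i ≠ β i) fun i => w i (α i)] at hlt
    have h : ∑ i ∈ T.filter (fun i => ¬ α i ≠ β i), w i (α i) =
        ∑ i ∈ T.filter (fun i => ¬ α i ≠ β i), w i (β i) :=
      Finset.sum_congr rfl fun i hi => by rw [not_not.1 (Finset.mem_filter.1 hi).2]
    rw [h] at hlt
    exact lt_of_add_lt_add_right hlt
  refine ⟨T.filter fun i => α i ≠ β i, α, β, ?_, hα.mono hsub, hβ.mono hsub, ?_,
    fun i hi => (Finset.mem_filter.1 hi).2, fun i hi => hPα i (hsub i hi),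
    fun i hi => hQβ i (hsub i hi), hlt'⟩
  · rw [Finset.nonempty_iff_ne_empty]
    intro h
    simp [h] at hlt'
  · ext j
    constructor
    · rintro ⟨i, hi, rfl⟩
      obtain ⟨hiT, hne⟩ := Finset.mem_filter.1 hi
      obtain ⟨i', hi', h⟩ : α i ∈ β '' T := himg ▸ ⟨i, hiT, rfl⟩
      refine ⟨i', Finset.mem_filter.2 ⟨hi', fun h' => ?_⟩, h⟩
      obtain rfl : i' = i := hα hi' hiT (h'.trans h)
      exact hne h.symm
    · rintro ⟨i, hi, rfl⟩
      obtain ⟨hiT, hne⟩ := Finset.mem_filter.1 hi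
      obtain ⟨i', hi', h⟩ : β i ∈ α '' T := himg ▸ ⟨i, hiT, rfl⟩
      refine ⟨i', Finset.mem_filter.2 ⟨hi', fun h' => ?_⟩, h⟩
      obtain rfl : i' = i := hβ hi' hiT (h'.symm.trans h)
      exact hne h

end Margins

/-! ### Binary quasi-minors as differences of two matchings -/

namespace QuasiMatrix

variable {R : Type u} {n m : ℕ}

theorem isBinary_of_ne_none_iff {p : ℕ} {A : QuasiMatrix p p R} (σ τ : Equiv.Perm (Fin p))
    (hne : ∀ l, σ l ≠ τ l) (h : ∀ i j, A i j ≠ none ↔ j = σ i ∨ j = τ i) : A.IsBinary := by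
  refine ⟨fun i _ => ?_, fun j _ => ?_⟩
  · rw [show {j | A i j ≠ none} = {σ i, τ i} from Set.ext fun j => h i j]
    exact Set.ncard_pair (hne i)
  · rw [show {i | A i j ≠ none} = {σ.symm j, τ.symm j} from Set.ext fun i => by
      rw [Set.mem_ofPred_eq, h, Set.mem_insert_iff, Set.mem_singleton_iff, Equiv.eq_symm_apply,
        Equiv.eq_symm_apply, eq_comm, eq_comm (a := j)]]
    refine Set.ncard_pair fun hj => hne (σ.symm j) ?_
    rw [Equiv.apply_symm_apply, hj, Equiv.apply_symm_apply]

/-- An injection from the rows in `T` to the columns in `U`, of equally many, is a permutation once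
rows and columns are numbered in increasing order. -/
theorem exists_perm_of_card_eq {T : Finset (Fin n)} {U : Finset (Fin m)} (hU : U.card = T.card)
    {α : Fin n → Fin m} (hα : Set.InjOn α T) (hαU : ∀ i ∈ T, α i ∈ U) :
    ∃ σ : Equiv.Perm (Fin T.card), ∀ i, U.orderEmbOfFin hU (σ i) = α (T.orderEmbOfFin rfl i) := by
  have hsurj : ∀ i, ∃ j, U.orderEmbOfFin hU j = α (T.orderEmbOfFin rfl i) := by
    intro i
    have h : α (T.orderEmbOfFin rfl i) ∈ (U : Set (Fin m)) :=
      hαU _ (Finset.orderEmbOfFin_mem T rfl i)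
    rwa [← Finset.range_orderEmbOfFin U hU] at h
  choose f hf using hsurj
  have hinj : Function.Injective f := by
    intro i i' h
    apply (T.orderEmbOfFin rfl).injective
    exact hα (Finset.orderEmbOfFin_mem T rfl i) (Finset.orderEmbOfFin_mem T rfl i')
      (by rw [← hf, ← hf, h])
  exact ⟨Equiv.ofBijective f (Finite.injective_iff_bijective.1 hinj), hf⟩

theorem prod_orderEmbOfFin {M : Type*} [CommMonoid M] (T : Finset (Fin n)) (f : Fin n → M) :
    ∏ l, f (T.orderEmbOfFin rfl l) = ∏ i ∈ T, f i := by
  rw [← Finset.prod_coe_sort T, ← Equiv.prod_comp (T.orderIsoOfFin rfl).toEquiv]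
  rfl

/-- Two disjoint matchings of the same rows with the same columns give a binary quasi-minor. -/
theorem prod_sub_prod_mem_binaryQuasiMinors [CommRing R] {B : QuasiMatrix n m R}
    {T : Finset (Fin n)} (hT : T.Nonempty) {α β : Fin n → Fin m} (hα : Set.InjOn α T)
    (hβ : Set.InjOn β T) (himg : α '' T = β '' T) (hne : ∀ i ∈ T, α i ≠ β i) {a b : Fin n → R}
    (ha : ∀ i ∈ T, B i (α i) = some (a i)) (hb : ∀ i ∈ T, B i (β i) = some (b i)) :
    ∏ i ∈ T, a i - ∏ i ∈ T, b i ∈ B.binaryQuasiMinors := by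
  classical
  have hU : (T.image α).card = T.card := Finset.card_image_of_injOn hα
  obtain ⟨σ, hσ⟩ := exists_perm_of_card_eq hU hα fun i hi => Finset.mem_image_of_mem α hi
  obtain ⟨τ, hτ⟩ := exists_perm_of_card_eq hU hβ fun i hi => by
    have h : β i ∈ α '' T := himg ▸ ⟨i, hi, rfl⟩
    simpa using h
  set r := T.orderEmbOfFin rfl with hr
  set c := (T.image α).orderEmbOfFin hU with hc
  have hrT : ∀ i, r i ∈ T := Finset.orderEmbOfFin_mem T rfl
  have hστ : ∀ l, σ l ≠ τ l := fun l h => hne (r l) (hrT l) (by rw [← hσ, ← hτ, h])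
  let D : QuasiMatrix T.card T.card R := fun i j =>
    if j = σ i ∨ j = τ i then B (r i) (c j) else none
  have hDσ : ∀ l, D l (σ l) = some (a (r l)) := fun l => by
    simp only [D, true_or, if_true]
    rw [hσ, ha _ (hrT l)]
  have hDτ : ∀ l, D l (τ l) = some (b (r l)) := fun l => by
    simp only [D, or_true, if_true]
    rw [hτ, hb _ (hrT l)]
  refine ⟨T.card, D, hT.card_pos, ⟨r, c, fun i j => ?_⟩, ?_, σ, τ, fun l => a (r l),
    fun l => b (r l), hστ, hDσ, hDτ, ?_⟩
  · by_cases h : j = σ i ∨ j = τ i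
    · exact Or.inr (if_pos h)
    · exact Or.inl (if_neg h)
  · refine isBinary_of_ne_none_iff σ τ hστ fun i j => ⟨fun h => ?_, ?_⟩
    · by_contra h'
      exact h (if_neg h')
    · rintro (rfl | rfl)
      · simp [hDσ]
      · simp [hDτ]
  · rw [prod_orderEmbOfFin, prod_orderEmbOfFin]

theorem exists_of_mem_binaryQuasiMinors [CommRing R] {B : QuasiMatrix n m R} {d : R}
    (hd : d ∈ B.binaryQuasiMinors) :
    ∃ (p : ℕ) (r : Fin p ↪o Fin n) (c : Fin p ↪o Fin m) (σ τ : Equiv.Perm (Fin p))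
      (a b : Fin p → R), (∀ l, B (r l) (c (σ l)) = some (a l)) ∧
      (∀ l, B (r l) (c (τ l)) = some (b l)) ∧ d = ∏ l, a l - ∏ l, b l := by
  obtain ⟨p, D, -, ⟨r, c, hD⟩, -, σ, τ, a, b, -, ha, hb, rfl⟩ := hd
  refine ⟨p, r, c, σ, τ, a, b, fun l => ?_, fun l => ?_, rfl⟩
  · rcases hD l (σ l) with h | h
    · rw [ha] at h
      cases h
    · rw [← h, ha]
  · rcases hD l (τ l) with h | h
    · rw [hb] at h
      cases h
    · rw [← h, hb]

theorem finite_binaryQuasiMinors [CommRing R] (B : QuasiMatrix n m R) :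
    B.binaryQuasiMinors.Finite := by
  refine (Set.finite_iUnion fun p : Fin (n + 1) => Set.finite_range
    fun x : (Fin p → Fin n) × (Fin p → Fin m) × (Fin p → Fin m) =>
      ∏ l, (B (x.1 l) (x.2.1 l)).getD 0 - ∏ l, (B (x.1 l) (x.2.2 l)).getD 0).subset ?_
  intro d hd
  obtain ⟨p, r, c, σ, τ, a, b, ha, hb, rfl⟩ := exists_of_mem_binaryQuasiMinors hd
  have hp : p ≤ n := by simpa using Fintype.card_le_of_embedding r.toEmbedding
  refine Set.mem_iUnion.2 ⟨⟨p, by omega⟩, ⟨r, fun l => c (σ l), fun l => c (τ l)⟩, ?_⟩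
  simp [ha, hb]

end QuasiMatrix

/-! ### Exponents as nonnegative integer matrices -/

section Exponents

variable {ι : Type v} {k m : ℕ}

/-- `IsPlacement x pos`: the array `x` of (possibly missing) variables has no repetitions, and
`pos` sends a variable to its position in `x`, if it has one. -/
def IsPlacement (x : Fin k → Fin m → Option ι) (pos : ι → Option (Fin k × Fin m)) : Prop :=
  ∀ y i j, x i j = some y ↔ pos y = some (i, j)

/-- The exponent in `u` of the variable at position `(i, j)` of `x`, zero if there is none. -/
def entryCount (x : Fin k → Fin m → Option ι) (u : ι →₀ ℕ) (i : Fin k) (j : Fin m) : ℕ :=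
  (x i j).elim 0 u

/-- The exponent of the variable at position `(i, j)` of `x`, zero if there is none. -/
noncomputable def entryExponent (x : Fin k → Fin m → Option ι) (i : Fin k) (j : Fin m) : ι →₀ ℕ :=
  (x i j).elim 0 fun y => Finsupp.single y 1

/-- The number of variables from each row of `x` that occur in `u`, with multiplicity. -/
def rowCount (x : Fin k → Fin m → Option ι) (u : ι →₀ ℕ) (i : Fin k) : ℕ :=
  ∑ j, entryCount x u i j

/-- The part of an exponent in the variables that have no position. -/
noncomputable def freePart (pos : ι → Option (Fin k × Fin m)) (u : ι →₀ ℕ) : ι →₀ ℕ :=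
  u.filter fun y => pos y = none

/-- The column of a variable; a variable without a position is its own label. -/
def columnLabel (pos : ι → Option (Fin k × Fin m)) (y : ι) : ι ⊕ Fin m :=
  (pos y).elim (Sum.inl y) fun p => Sum.inr p.2

/-- The element of `s` attached to the row of a variable, `1` for a variable without a position. -/
def rowCoeff {R : Type u} [CommRing R] (s : Fin k → R) (pos : ι → Option (Fin k × Fin m))
    (y : ι) : R :=
  (pos y).elim 1 fun p => s p.1

variable {x : Fin k → Fin m → Option ι} {pos : ι → Option (Fin k × Fin m)}

theorem freePart_apply_of_eq_none {u : ι →₀ ℕ} {y : ι} (h : pos y = none) :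
    freePart pos u y = u y :=
  Finsupp.filter_apply_pos (fun y => pos y = none) u h

theorem freePart_apply_of_ne_none {u : ι →₀ ℕ} {y : ι} (h : pos y ≠ none) :
    freePart pos u y = 0 :=
  Finsupp.filter_apply_neg (fun y => pos y = none) u h

theorem exists_eq_some_of_entryCount_ne_zero {u : ι →₀ ℕ} {i : Fin k} {j : Fin m}
    (h : entryCount x u i j ≠ 0) : ∃ y, x i j = some y := by
  rw [entryCount] at h
  cases hx : x i j with
  | none => simp [hx] at h
  | some y => exact ⟨y, rfl⟩

/-- An exponent is recovered from its free part and its multiplicities at the positions. -/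
theorem IsPlacement.freePart_add_sum (hx : IsPlacement x pos) (u : ι →₀ ℕ) :
    freePart pos u + ∑ i, ∑ j, entryCount x u i j • entryExponent x i j = u := by
  ext y
  simp only [Finsupp.add_apply, Finsupp.finsetSum_apply, Finsupp.smul_apply]
  cases hy : pos y with
  | none =>
    rw [freePart_apply_of_eq_none hy, Finset.sum_eq_zero, add_zero]
    refine fun i _ => Finset.sum_eq_zero fun j _ => ?_
    cases hij : x i j with
    | none => simp [entryExponent, hij]
    | some z =>
      have hzy : z ≠ y := by
        rintro rfl
        rw [(hx _ _ _).1 hij] at hy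
        cases hy
      simp [entryExponent, hij, hzy]
  | some p =>
    obtain ⟨i, j⟩ := p
    have hij := (hx y i j).2 hy
    rw [freePart_apply_of_ne_none (by simp [hy]), zero_add, Finset.sum_eq_single i,
      Finset.sum_eq_single j]
    · simp [entryCount, entryExponent, hij]
    · intro j' _ hj'
      cases h : x i j' with
      | none => simp [entryExponent, h]
      | some z =>
        have hzy : z ≠ y := by
          rintro rfl
          rw [(hx _ _ _).1 h] at hy
          cases hy
          exact hj' rfl
        simp [entryExponent, h, hzy]
    · simp
    · intro i' _ hi'
      refine Finset.sum_eq_zero fun j' _ => ?_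
      cases h : x i' j' with
      | none => simp [entryExponent, h]
      | some z =>
        have hzy : z ≠ y := by
          rintro rfl
          rw [(hx _ _ _).1 h] at hy
          cases hy
          exact hi' rfl
        simp [entryExponent, h, hzy]
    · simp

theorem IsPlacement.mapDomain_columnLabel (hx : IsPlacement x pos) (u : ι →₀ ℕ) :
    u.mapDomain (columnLabel pos) = (freePart pos u).mapDomain Sum.inl +
      ∑ i, ∑ j, entryCount x u i j • Finsupp.single (Sum.inr j) 1 := by
  conv_lhs => rw [← hx.freePart_add_sum u]
  rw [Finsupp.mapDomain_add]
  congr 1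
  · refine Finsupp.mapDomain_congr fun y hy => ?_
    have : pos y = none := by
      by_contra h
      exact Finsupp.mem_support_iff.1 hy (freePart_apply_of_ne_none h)
    simp [columnLabel, this]
  · simp only [← Finsupp.mapDomain.addMonoidHom_apply, map_sum, map_nsmul]
    refine Finset.sum_congr rfl fun i _ => Finset.sum_congr rfl fun j _ => ?_
    cases hij : x i j with
    | none => simp [entryCount, hij]
    | some y =>
      simp [entryExponent, hij, columnLabel, (hx y i j).1 hij]

theorem IsPlacement.mapDomain_columnLabel_inr (hx : IsPlacement x pos) (u : ι →₀ ℕ) (j : Fin m) :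
    u.mapDomain (columnLabel pos) (Sum.inr j) = ∑ i, entryCount x u i j := by
  rw [hx.mapDomain_columnLabel, Finsupp.add_apply, Finsupp.mapDomain_of_notMem_range, zero_add]
  · simp only [Finsupp.finsetSum_apply, Finsupp.smul_apply]
    refine Finset.sum_congr rfl fun i _ => ?_
    rw [Finset.sum_eq_single j]
    · simp
    · intro j' _ hj'
      simp [hj']
    · simp
  · simp

theorem IsPlacement.mapDomain_columnLabel_inl (hx : IsPlacement x pos) (u : ι →₀ ℕ) (y : ι) :
    u.mapDomain (columnLabel pos) (Sum.inl y) = freePart pos u y := by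
  rw [hx.mapDomain_columnLabel, Finsupp.add_apply, Finsupp.mapDomain_apply Sum.inl_injective]
  simp [Finsupp.finsetSum_apply]

/-- The elements of `s` contributed by the variables of `u` under `rowColumnHom` multiply to the
monomial whose exponents are the row counts. -/
theorem IsPlacement.prod_rowCoeff {R : Type u} [CommRing R] (hx : IsPlacement x pos)
    (s : Fin k → R) (u : ι →₀ ℕ) :
    u.prod (fun y e => rowCoeff s pos y ^ e) = monomialIn s (rowCount x u) := by
  have hadd : ∀ a b : ι →₀ ℕ, (a + b).prod (fun y e => rowCoeff s pos y ^ e) =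
      a.prod (fun y e => rowCoeff s pos y ^ e) * b.prod (fun y e => rowCoeff s pos y ^ e) :=
    fun a b => Finsupp.prod_add_index' (fun _ => pow_zero _) fun _ _ _ => pow_add _ _ _
  let F : Multiplicative (ι →₀ ℕ) →* R :=
    { toFun := fun a => a.toAdd.prod (fun y e => rowCoeff s pos y ^ e)
      map_one' := Finsupp.prod_zero_index
      map_mul' := fun a b => hadd a.toAdd b.toAdd }
  have hF : ∀ a : ι →₀ ℕ, a.prod (fun y e => rowCoeff s pos y ^ e) = F (Multiplicative.ofAdd a) :=
    fun _ => rfl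
  conv_lhs => rw [← hx.freePart_add_sum u]
  rw [hadd, hF (∑ i, _), ofAdd_sum, map_prod]
  have hfree : (freePart pos u).prod (fun y e => rowCoeff s pos y ^ e) = 1 := by
    refine Finset.prod_eq_one fun y hy => ?_
    have : pos y = none := by
      by_contra h
      exact Finsupp.mem_support_iff.1 hy (freePart_apply_of_ne_none h)
    simp [rowCoeff, this]
  rw [hfree, one_mul, monomialIn]
  refine Finset.prod_congr rfl fun i _ => ?_
  rw [ofAdd_sum, map_prod, rowCount, ← Finset.prod_pow_eq_pow_sum]
  refine Finset.prod_congr rfl fun j _ => ?_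
  rw [ofAdd_nsmul, map_pow, ← hF]
  cases hij : x i j with
  | none => simp [entryCount, hij]
  | some y =>
    simp [entryExponent, hij, rowCoeff, (hx y i j).1 hij]

end Exponents

/-! ### The parametrization -/

section Parametrization

variable {R : Type u} [CommRing R] {ι : Type v} {k m : ℕ}

/-- The substitution of `s i * t j` for the variable at position `(i, j)`, where `t j` is a new
variable for each column; the remaining variables are left alone. -/
noncomputable def rowColumnHom (s : Fin k → R) (pos : ι → Option (Fin k × Fin m)) :
    MvPolynomial ι R →ₐ[R] MvPolynomial (ι ⊕ Fin m) R :=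
  aeval fun y => C (rowCoeff s pos y) * X (columnLabel pos y)

variable {x : Fin k → Fin m → Option ι} {pos : ι → Option (Fin k × Fin m)}

theorem IsPlacement.rowColumnHom_monomial (hx : IsPlacement x pos) (s : Fin k → R)
    (u : ι →₀ ℕ) (c : R) :
    rowColumnHom s pos (monomial u c) =
      monomial (u.mapDomain (columnLabel pos)) (monomialIn s (rowCount x u) * c) := by
  have h : ∀ a : ι →₀ ℕ, (a.prod fun y e => (X (columnLabel pos y) : MvPolynomial _ R) ^ e) =
      monomial (a.mapDomain (columnLabel pos)) 1 := by
    intro a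
    rw [monomial_eq, Finsupp.prod_mapDomain_index (fun _ => pow_zero _)
      fun _ _ _ => pow_add _ _ _]
    simp
  rw [rowColumnHom, aeval_monomial]
  simp only [mul_pow, Finsupp.prod_mul]
  rw [h, ← hx.prod_rowCoeff s u, algebraMap_eq, Finsupp.prod]
  simp only [← C_pow, ← map_prod]
  rw [C_mul_monomial, C_mul_monomial, Finsupp.prod]
  congr 1
  ring

theorem IsPlacement.coeff_rowColumnHom (hx : IsPlacement x pos) (s : Fin k → R)
    (f : MvPolynomial ι R) (γ : ι ⊕ Fin m →₀ ℕ) [DecidableEq ι] :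
    (rowColumnHom s pos f).coeff γ =
      ∑ u ∈ f.support with u.mapDomain (columnLabel pos) = γ,
        monomialIn s (rowCount x u) * f.coeff u := by
  conv_lhs => rw [f.as_sum, map_sum, coeff_sum]
  rw [Finset.sum_filter]
  refine Finset.sum_congr rfl fun u _ => ?_
  rw [hx.rowColumnHom_monomial, coeff_monomial]

end Parametrization

/-! ### Leading terms in the kernel of the parametrization -/

theorem QuasiMatrix.IsGeneric.exists_isPlacement {R : Type u} [CommRing R] [Nontrivial R]
    {ι : Type v} {k m : ℕ} {A : QuasiMatrix k m (MvPolynomial ι R)} (hA : A.IsGeneric) :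
    ∃ (x : Fin k → Fin m → Option ι) (pos : ι → Option (Fin k × Fin m)), IsPlacement x pos ∧
      ∀ i j, A i j = (x i j).map X := by
  classical
  have hx : ∀ i j, ∃ z : Option ι, A i j = z.map X := by
    intro i j
    cases h : A i j with
    | none => exact ⟨none, rfl⟩
    | some a =>
      obtain ⟨y, rfl⟩ := hA.1 i j a h
      exact ⟨some y, rfl⟩
  choose x hx using hx
  have hinj : ∀ y i j i' j', x i j = some y → x i' j' = some y → i = i' ∧ j = j' := by
    intro y i j i' j' h h'
    exact hA.2 i j i' j' (X y) (by rw [hx, h]; rfl) (by rw [hx, h']; rfl)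
  refine ⟨x, fun y => if h : ∃ p : Fin k × Fin m, x p.1 p.2 = some y then some h.choose else none,
    fun y i j => ⟨fun h => ?_, fun h => ?_⟩, hx⟩
  · have hex : ∃ p : Fin k × Fin m, x p.1 p.2 = some y := ⟨(i, j), h⟩
    change (if h : ∃ p : Fin k × Fin m, x p.1 p.2 = some y then some h.choose else none) = _
    rw [dif_pos hex]
    obtain ⟨h1, h2⟩ := hinj y _ _ _ _ hex.choose_spec h
    rw [Option.some_inj]
    exact Prod.ext h1 h2
  · change (if h : ∃ p : Fin k × Fin m, x p.1 p.2 = some y then some h.choose else none) = _ at h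
    split_ifs at h with hex
    rw [Option.some_inj] at h
    have := hex.choose_spec
    rwa [h] at this

section LeadingTerms

variable {R : Type u} [CommRing R] {ι : Type v} {k m : ℕ}

/-- The exponents of the entries of `(s | A)`: a column of zeros is added to `entryExponent`. -/
noncomputable def extendedExponent (x : Fin k → Fin m → Option ι) (i : Fin k) :
    Fin (m + 1) → ι →₀ ℕ :=
  Fin.cons 0 (entryExponent x i)

/-- The coefficients of the entries of `(s | A)`. -/
def extendedCoeff (s : Fin k → R) (i : Fin k) : Fin (m + 1) → R :=
  Fin.cons (s i) fun _ => 1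

/-- The matrix of multiplicities of the entries of `(s | A)` in `∏ i, s i ^ p i` times the monomial
with exponent `u`. -/
def extendedCount (x : Fin k → Fin m → Option ι) (p : Fin k → ℕ) (u : ι →₀ ℕ) (i : Fin k) :
    Fin (m + 1) → ℕ :=
  Fin.cons (p i) (entryCount x u i)

variable {x : Fin k → Fin m → Option ι} {pos : ι → Option (Fin k × Fin m)}

theorem addCol_eq_some_monomial {A : QuasiMatrix k m (MvPolynomial ι R)}
    (hA : ∀ i j, A i j = (x i j).map X) (s : Fin k → R) {p : Fin k → ℕ} {u : ι →₀ ℕ} {i : Fin k}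
    {j : Fin (m + 1)} (h : extendedCount x p u i j ≠ 0) :
    A.addCol (fun i => C (s i)) i j =
      some (monomial (extendedExponent x i j) (extendedCoeff s i j)) := by
  cases j using Fin.cases with
  | zero => rfl
  | succ j =>
    obtain ⟨y, hy⟩ := exists_eq_some_of_entryCount_ne_zero (show entryCount x u i j ≠ 0 from h)
    simp only [QuasiMatrix.addCol, extendedExponent, extendedCoeff, Fin.cons_succ, entryExponent]
    rw [hA, hy]
    rfl

theorem sum_extendedCount (p : Fin k → ℕ) (u : ι →₀ ℕ) (i : Fin k) :
    ∑ j, extendedCount x p u i j = p i + rowCount x u i := by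
  rw [Fin.sum_univ_succ]
  rfl

theorem IsPlacement.freePart_add_sum_extended (hx : IsPlacement x pos) (p : Fin k → ℕ)
    (u : ι →₀ ℕ) :
    freePart pos u + ∑ i, ∑ j, extendedCount x p u i j • extendedExponent x i j = u := by
  conv_rhs => rw [← hx.freePart_add_sum u]
  congr 1
  refine Finset.sum_congr rfl fun i _ => ?_
  rw [Fin.sum_univ_succ]
  simp [extendedCount, extendedExponent]

theorem prod_extendedCoeff_pow (s : Fin k → R) (p : Fin k → ℕ) (u : ι →₀ ℕ) :
    ∏ i, ∏ j, extendedCoeff s i j ^ extendedCount x p u i j = monomialIn s p := by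
  refine Finset.prod_congr rfl fun i _ => ?_
  rw [Fin.prod_univ_succ]
  simp [extendedCount, extendedCoeff]

theorem MonomialOrder.leadingTerm_monomial_sub_monomial (ord : MonomialOrder.{v, w} ι)
    {a b : ι →₀ ℕ} {c d : R} (hc : c ≠ 0) (h : ord.toSyn b < ord.toSyn a) :
    ord.leadingTerm (monomial a c - monomial b d) = monomial a c := by
  classical
  have hdeg : ord.degree (monomial a c) = a := by rw [MonomialOrder.degree_monomial, if_neg hc]
  have hlt : ord.toSyn (ord.degree (monomial b d)) < ord.toSyn (ord.degree (monomial a c)) := by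
    rw [hdeg]
    exact (MonomialOrder.degree_monomial_le d).trans_lt h
  rw [MonomialOrder.leadingTerm, MonomialOrder.degree_sub_of_lt hlt,
    MonomialOrder.leadingCoeff_sub_of_lt hlt, hdeg, MonomialOrder.leadingCoeff_monomial]

/-- If `u` and `u₀` have the same column degrees and `u < u₀`, then `u₀`, multiplied by the powers
of the `s i` that are needed to make up for the excess of `u` in each row, is a multiple of the
leading term of a binary quasi-minor. -/
theorem IsPlacement.monomial_mem_span_leadingTerm [Nontrivial R] (hx : IsPlacement x pos)
    {A : QuasiMatrix k m (MvPolynomial ι R)} (hA : ∀ i j, A i j = (x i j).map X) {s : Fin k → R}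
    (hs : ∀ i, s i ∈ nonZeroDivisors R) (ord : MonomialOrder.{v, w} ι) {u u₀ : ι →₀ ℕ}
    (hlt : ord.toSyn u < ord.toSyn u₀)
    (hlab : u.mapDomain (columnLabel pos) = u₀.mapDomain (columnLabel pos)) :
    monomial u₀ (monomialIn s (rowCount x u - rowCount x u₀)) ∈
      Ideal.span (ord.leadingTerm '' (A.addCol fun i => C (s i)).binaryQuasiMinors) := by
  set p : Fin k → ℕ := rowCount x u - rowCount x u₀ with hp
  set q : Fin k → ℕ := rowCount x u₀ - rowCount x u with hq
  have hpq : ∀ i, p i + rowCount x u₀ i = q i + rowCount x u i := by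
    intro i
    simp only [hp, hq, Pi.sub_apply]
    omega
  have hcol : ∀ j, ∑ i, entryCount x u₀ i j = ∑ i, entryCount x u i j := fun j => by
    rw [← hx.mapDomain_columnLabel_inr, ← hx.mapDomain_columnLabel_inr, hlab]
  have hfree : freePart pos u₀ = freePart pos u := by
    ext y
    rw [← hx.mapDomain_columnLabel_inl, ← hx.mapDomain_columnLabel_inl, hlab]
  have htot : ∑ i, rowCount x u₀ i = ∑ i, rowCount x u i := by
    simp only [rowCount]
    rw [Finset.sum_comm, Finset.sum_congr rfl fun j _ => hcol j, Finset.sum_comm]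
  have hsum : ∑ i, p i = ∑ i, q i := by
    have h := Finset.sum_congr (rfl : (Finset.univ : Finset (Fin k)) = _) fun i _ => hpq i
    rw [Finset.sum_add_distrib, Finset.sum_add_distrib, htot] at h
    exact Nat.add_right_cancel h
  have hw : ∑ i, ∑ j, extendedCount x q u i j • ord.toSyn (extendedExponent x i j) <
      ∑ i, ∑ j, extendedCount x p u₀ i j • ord.toSyn (extendedExponent x i j) := by
    rw [← hx.freePart_add_sum_extended q u, ← hx.freePart_add_sum_extended p u₀, hfree, map_add,
      map_add] at hlt
    simpa only [map_sum, map_nsmul] using lt_of_add_lt_add_left hlt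
  obtain ⟨T, α, β, hT, hα, hβ, himg, hne, hPα, hQβ, hwT⟩ :=
    exists_disjoint_matchings_of_weight_lt (fun i j => ord.toSyn (extendedExponent x i j))
      (extendedCount x p u₀) (extendedCount x q u)
      (fun i => by rw [sum_extendedCount, sum_extendedCount, hpq])
      (fun j => by
        cases j using Fin.cases with
        | zero => exact hsum
        | succ j => exact hcol j) hw
  have hminor := QuasiMatrix.prod_sub_prod_mem_binaryQuasiMinors hT hα hβ himg hne
    (fun i hi => addCol_eq_some_monomial hA s (hPα i hi))
    (fun i hi => addCol_eq_some_monomial hA s (hQβ i hi))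
  rw [← monomial_sum_prod, ← monomial_sum_prod] at hminor
  set M := ∑ i ∈ T, extendedExponent x i (α i) with hM
  set c := ∏ i ∈ T, extendedCoeff s i (α i) with hc
  have hc0 : c ≠ 0 := by
    refine nonZeroDivisors.ne_zero (Submonoid.prod_mem _ fun i _ => ?_)
    cases α i using Fin.cases with
    | zero => exact hs i
    | succ j => exact one_mem _
  have hLT := MonomialOrder.leadingTerm_monomial_sub_monomial ord
    (a := M) (b := ∑ i ∈ T, extendedExponent x i (β i)) (c := c)
    (d := ∏ i ∈ T, extendedCoeff s i (β i)) hc0 (by simpa only [hM, map_sum] using hwT)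
  have hmem : monomial M c ∈
      Ideal.span (ord.leadingTerm '' (A.addCol fun i => C (s i)).binaryQuasiMinors) :=
    Ideal.subset_span ⟨_, hminor, hLT⟩
  have hMle : M ≤ u₀ := by
    calc M ≤ ∑ i ∈ T, ∑ j, extendedCount x p u₀ i j • extendedExponent x i j := by
          refine Finset.sum_le_sum fun i hi => ?_
          refine le_trans ?_ (Finset.single_le_sum
            (f := fun j => extendedCount x p u₀ i j • extendedExponent x i j)
            (fun j _ => zero_le) (Finset.mem_univ (α i)))
          obtain ⟨e, he⟩ := Nat.exists_eq_succ_of_ne_zero (hPα i hi)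
          simp only [he, succ_nsmul]
          exact le_add_self
      _ ≤ ∑ i, ∑ j, extendedCount x p u₀ i j • extendedExponent x i j :=
          Finset.sum_le_sum_of_subset (Finset.subset_univ T)
      _ ≤ freePart pos u₀ + ∑ i, ∑ j, extendedCount x p u₀ i j • extendedExponent x i j :=
          le_add_self
      _ = u₀ := hx.freePart_add_sum_extended p u₀
  have hcdvd : c ∣ monomialIn s p := by
    rw [← prod_extendedCoeff_pow (x := x) s p u₀]
    refine dvd_trans (Finset.prod_dvd_prod_of_dvd _ _ fun i hi => ?_)
      (Finset.prod_dvd_prod_of_subset _ _ _ (Finset.subset_univ T))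
    exact (dvd_pow_self _ (hPα i hi)).trans (Finset.dvd_prod_of_mem
      (fun j => extendedCoeff s i j ^ extendedCount x p u₀ i j) (Finset.mem_univ (α i)))
  obtain ⟨e, he⟩ := hcdvd
  have : monomial u₀ (monomialIn s p) = monomial (u₀ - M) e * monomial M c := by
    rw [monomial_mul, tsub_add_cancel_of_le hMle, he, mul_comm]
  rw [this]
  exact Ideal.mul_mem_left _ _ hmem

theorem IsPlacement.rowColumnHom_eq_zero (hx : IsPlacement x pos)
    {A : QuasiMatrix k m (MvPolynomial ι R)} (hA : ∀ i j, A i j = (x i j).map X) (s : Fin k → R)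
    {f : MvPolynomial ι R} (hf : f ∈ (A.addCol fun i => C (s i)).Ibin) :
    rowColumnHom s pos f = 0 := by
  -- the columns of `(s | A)` correspond to `1` and the column variables
  let t : Fin (m + 1) → MvPolynomial (ι ⊕ Fin m) R := Fin.cons 1 fun j => X (Sum.inr j)
  have hentry : ∀ i j b, A.addCol (fun i => C (s i)) i j = some b →
      rowColumnHom s pos b = C (s i) * t j := by
    intro i j b hb
    cases j using Fin.cases with
    | zero =>
      obtain rfl : C (s i) = b := Option.some_inj.1 hb
      simp [rowColumnHom, t, algebraMap_eq]
    | succ j =>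
      simp only [QuasiMatrix.addCol, Fin.cons_succ] at hb
      rw [hA] at hb
      obtain ⟨y, hy, rfl⟩ := Option.map_eq_some_iff.1 hb
      simp [rowColumnHom, t, rowCoeff, columnLabel, (hx y i j).1 hy]
  suffices h : (A.addCol fun i => C (s i)).Ibin ≤ RingHom.ker (rowColumnHom s pos) from h hf
  rw [QuasiMatrix.Ibin, Ideal.span_le]
  intro d hd
  obtain ⟨p, r, c, σ, τ, a, b, ha, hb, rfl⟩ := QuasiMatrix.exists_of_mem_binaryQuasiMinors hd
  rw [SetLike.mem_coe, RingHom.mem_ker, map_sub, map_prod, map_prod,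
    Finset.prod_congr rfl fun l _ => hentry _ _ _ (ha l),
    Finset.prod_congr rfl fun l _ => hentry _ _ _ (hb l), Finset.prod_mul_distrib,
    Finset.prod_mul_distrib, Equiv.prod_comp σ fun l => t (c l), Equiv.prod_comp τ fun l => t (c l),
    sub_self]

/-- The binary quasi-minors of `(s | A)` have enough leading terms to generate the leading
terms of the whole kernel of `rowColumnHom`. -/
theorem IsPlacement.leadingTerm_mem [Nontrivial R] (hx : IsPlacement x pos)
    {A : QuasiMatrix k m (MvPolynomial ι R)} (hA : ∀ i j, A i j = (x i j).map X) {s : Fin k → R}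
    (hs : IsPermutableWeakRegular s) (ord : MonomialOrder.{v, w} ι) {f : MvPolynomial ι R}
    (hf : rowColumnHom s pos f = 0) :
    ord.leadingTerm f ∈
      Ideal.span (ord.leadingTerm '' (A.addCol fun i => C (s i)).binaryQuasiMinors) := by
  classical
  set L := Ideal.span (ord.leadingTerm '' (A.addCol fun i => C (s i)).binaryQuasiMinors) with hL
  by_cases hf0 : f = 0
  · rw [hf0, MonomialOrder.leadingTerm_zero]
    exact zero_mem _
  have hreg : ∀ i, s i ∈ nonZeroDivisors R := fun i => by
    rw [mem_nonZeroDivisors_iff_right]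
    intro c hc
    have h := hs.mem_span_of_mul_mem ∅ i (Finset.notMem_empty i) c
    simp only [Finset.coe_empty, Set.image_empty, Ideal.span_empty, Ideal.mem_bot] at h
    exact h (by rw [mul_comm, hc])
  set u₀ := ord.degree f with hu₀
  have hmem₀ : u₀ ∈ f.support := MonomialOrder.degree_mem_support hf0
  -- the other exponents of `f` with the same column degrees
  set W := (f.support.filter fun u =>
    u.mapDomain (columnLabel pos) = u₀.mapDomain (columnLabel pos)).erase u₀ with hW
  have hWmem : ∀ u ∈ W, ord.toSyn u < ord.toSyn u₀ ∧
      u.mapDomain (columnLabel pos) = u₀.mapDomain (columnLabel pos) := by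
    intro u hu
    obtain ⟨hne, hu⟩ := Finset.mem_erase.1 hu
    obtain ⟨hu, hlab⟩ := Finset.mem_filter.1 hu
    exact ⟨lt_of_le_of_ne (MonomialOrder.le_degree hu) fun h => hne (ord.toSyn.injective h), hlab⟩
  have hcoeff := hx.coeff_rowColumnHom s f (u₀.mapDomain (columnLabel pos))
  have hmem₀' : u₀ ∈ f.support.filter fun u =>
      u.mapDomain (columnLabel pos) = u₀.mapDomain (columnLabel pos) :=
    Finset.mem_filter.2 ⟨hmem₀, rfl⟩
  rw [hf, coeff_zero, ← Finset.add_sum_erase _ _ hmem₀'] at hcoeff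
  have hcolon := mem_of_monomialIn_mul_mem hs.mem_span_of_mul_mem
    (W.val.map fun u => rowCount x u) (rowCount x u₀) (f.coeff u₀) (by
      rw [eq_neg_of_add_eq_zero_left hcoeff.symm]
      refine neg_mem (Ideal.sum_mem _ fun u hu => Ideal.mul_mem_right _ _ ?_)
      exact monomialIn_mem (Multiset.mem_map_of_mem _ hu))
  rw [Multiset.map_map] at hcolon
  have hle : monomialIdealIn s (W.val.map ((fun b => b - rowCount x u₀) ∘ fun u => rowCount x u)) ≤
      Submodule.comap (monomial u₀ : R →ₗ[R] MvPolynomial ι R) (L.restrictScalars R) := by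
    rw [monomialIdealIn_le_iff]
    intro b hb
    obtain ⟨u, hu, rfl⟩ := Multiset.mem_map.1 hb
    obtain ⟨hlt, hlab⟩ := hWmem u hu
    exact hx.monomial_mem_span_leadingTerm hA hreg ord hlt hlab
  exact hle hcolon

end LeadingTerms

theorem mainTheorem4 {R : Type u} [CommRing R] {ι : Type v} [Finite ι] {k m : ℕ}
    (s : Fin k → R) (hs : IsPermutableWeakRegular s) (hunit : ∀ i, ¬ IsUnit (s i))
    (A : QuasiMatrix k m (MvPolynomial ι R)) (hA : A.IsGeneric) :
    IsUniversalGroebnerBasis.{u, v, w}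
      (QuasiMatrix.addCol (fun i => C (s i)) A).binaryQuasiMinors
      (QuasiMatrix.addCol (fun i => C (s i)) A).Ibin := by
  intro ord
  have hsub : (A.addCol fun i => C (s i)).binaryQuasiMinors ⊆
      ((A.addCol fun i => C (s i)).Ibin : Set (MvPolynomial ι R)) := Ideal.subset_span
  refine ⟨QuasiMatrix.finite_binaryQuasiMinors _, hsub,
    le_antisymm (Ideal.span_mono (Set.image_mono hsub)) ?_⟩
  rw [Ideal.span_le]
  rintro _ ⟨f, hf, rfl⟩
  nontriviality R
  obtain ⟨x, pos, hx, hAx⟩ := hA.exists_isPlacement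
  exact hx.leadingTerm_mem hAx hs ord (hx.rowColumnHom_eq_zero hAx s hf)
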